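/- Let $S=(S_t)_{t\ge 0}$ denote a positive Gamma process with $S_0=0$: increasing right-continuous paths, independent increments, and $S_t-S_s$ Gamma distributed with shape $t-s$ and rate $1$ for $s<t$. For locally integrable $h\ge 0$ on $[0,\infty)$ write $$\lambda_t h=\int_0^t h(x)\,dx,\qquad v_t(h)=\frac{\lambda_t (h^2)}{(\lambda_t h)^2},\qquad b_t(h)=\frac{h(t)}{\lambda_t h},\qquad R_t(h)=\frac{\int_0^t h\,dS}{\lambda_t h},$$ where $\int_0^t h\,dS$ is the pathwise Lebesgue-Stieltjes integral. For $0\le p<\infty$, $h$ satisfies orderly divergence in $L^p$ if $\lambda_t h\to\infty$ and $R_t(h)\to 1$ in $L^p$ as $t\to\infty$ (for $p=0$: in probability). Theorem. Let $g\ge 0$ be a measurable periodic function with $\operatorname{ess\,sup} g=1$. There is a constant $C>0$, depending only on $g$, such that the following holds for every increasing (i.e. nondecreasing) function $f:[0,\infty)\to[0,\infty)$ with $\lambda_t f\to\infty$ that satisfies one of the conditions: orderly divergence in probability; $v_t(f)\to 0$; $b_t(f)\to 0$. The product $fg$ is locally square integrable, $$v_t(fg)\le C\,v_t(f)\quad\text{for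 all sufficiently large } t,$$ and $fg$ satisfies orderly divergence in $L^p$ for every $0\le p<\infty$. -/

import Mathlib

open MeasureTheory ProbabilityTheory Filter Set
open scoped NNReal ENNReal Topology

universe u v

/-- A positive Gamma process on `[0, ∞)`: it starts at `0`, has increasing right-continuous paths
and independent increments, and the increment over `(s, t]` has the Gamma distribution with
shape `t - s` and rate `1`; in particular the value at time `1` is exponential with mean `1`. -/
structure GammaProcess {Ω : Type*} [MeasurableSpace Ω] (P : Measure Ω) where
  /-- the value of the process at a time, as a random variable -/
  toFun : ℝ≥0 → Ω → ℝ
  measurable_toFun : ∀ t, Measurable (toFun t)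
  map_zero : ∀ ω, toFun 0 ω = 0
  mono : ∀ ω, Monotone fun t => toFun t ω
  right_continuous : ∀ ω t, ContinuousWithinAt (fun u => toFun u ω) (Ici t) t
  indep : HasIndepIncrements toFun P
  law : ∀ s t : ℝ≥0, s < t →
    P.map (fun ω => toFun t ω - toFun s ω) = gammaMeasure ((t : ℝ) - (s : ℝ)) 1

namespace GammaProcess

variable {Ω : Type*} [MeasurableSpace Ω] {P : Measure Ω}

/-- A path of the process, extended by `0` to negative times. -/
def path (S : GammaProcess P) (ω : Ω) : StieltjesFunction ℝ where
  toFun x := S.toFun x.toNNReal ω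
  mono' _ _ h := S.mono ω (Real.toNNReal_mono h)
  right_continuous' x :=
    (S.right_continuous ω x.toNNReal).comp continuous_real_toNNReal.continuousWithinAt
      fun _ h => Real.toNNReal_mono h

/-- The pathwise Gamma integral `∫₀ᵗ f dS`: the integral of `f` over `(0, t]` with respect to the
Lebesgue-Stieltjes measure of the path (the path has no mass at `0`). -/
noncomputable def integral (S : GammaProcess P) (f : ℝ → ℝ) (t : ℝ) (ω : Ω) : ℝ :=
  ∫ x in Ioc 0 t, f x ∂(S.path ω).measure

end GammaProcess

/-- `λ_t f = ∫₀ᵗ f(x) dx`. -/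
noncomputable def cumul (f : ℝ → ℝ) (t : ℝ) : ℝ := ∫ x in (0 : ℝ)..t, f x

/-- `v_t(f) = λ_t(f²) / (λ_t f)²`. -/
noncomputable def vChar (f : ℝ → ℝ) (t : ℝ) : ℝ := cumul (fun x => f x ^ 2) t / cumul f t ^ 2

/-- `b_t(f) = f(t) / λ_t f`. -/
noncomputable def bChar (f : ℝ → ℝ) (t : ℝ) : ℝ := f t / cumul f t

/-- Convergence in `L^p`, `0 ≤ p < ∞`, as `t → ∞`, of real random variables `R t` to a constant `c`;
for `p = 0` this is convergence in probability. -/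
def ConvergesInLp {Ω : Type*} [MeasurableSpace Ω] (P : Measure Ω) (p : ℝ≥0) (R : ℝ → Ω → ℝ)
    (c : ℝ) : Prop :=
  (∀ᶠ t in atTop, MemLp (R t) (p : ℝ≥0∞) P) ∧
    if p = 0 then TendstoInMeasure P R atTop (fun _ => c)
    else Tendsto (fun t => eLpNorm (fun ω => R t ω - c) (p : ℝ≥0∞) P) atTop (𝓝 0)

/-- Orderly divergence of `f` in `L^p`: `f` is locally integrable on `[0, ∞)`, `λ_t f → ∞`, and
`R_t = (∫₀ᵗ f dS) / λ_t f` converges to `1` in `L^p`. -/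
def OrderlyDivergent {Ω : Type*} [MeasurableSpace Ω] {P : Measure Ω} (S : GammaProcess P)
    (p : ℝ≥0) (f : ℝ → ℝ) : Prop :=
  (∀ t, IntegrableOn f (Ioc 0 t)) ∧ Tendsto (cumul f) atTop atTop ∧
    ConvergesInLp P p (fun t ω => S.integral f t ω / cumul f t) 1

/-- The class OD: orderly divergence in probability. The property depends only on the law of the
process, so it does not matter which Gamma process is used. -/
def InClassOD (f : ℝ → ℝ) : Prop :=
  ∃ (Ω : Type u) (_ : MeasurableSpace Ω) (P : Measure Ω) (_ : IsProbabilityMeasure P)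
    (S : GammaProcess P), OrderlyDivergent S 0 f

/-- The class `V`: `f` is locally square integrable, `λ_t f → ∞` and `v_t(f) → 0`. -/
def InClassV (f : ℝ → ℝ) : Prop :=
  (∀ t, MemLp f 2 (volume.restrict (Ioc 0 t))) ∧ Tendsto (cumul f) atTop atTop ∧
    Tendsto (vChar f) atTop (𝓝 0)

/-- The class `B`: `f` is locally integrable, `λ_t f → ∞` and `b_t(f) → 0`. -/
def InClassB (f : ℝ → ℝ) : Prop :=
  (∀ t, IntegrableOn f (Ioc 0 t)) ∧ Tendsto (cumul f) atTop atTop ∧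
    Tendsto (bChar f) atTop (𝓝 0)

/-- The periodic factor of a regular quasi-periodic product: a measurable periodic function `g ≥ 0`
with essential supremum `1`. -/
structure IsRegularPeriodicFactor (g : ℝ → ℝ) : Prop where
  measurable : Measurable g
  nonneg : ∀ x, 0 ≤ g x
  periodic : ∃ T : ℝ, 0 < T ∧ Function.Periodic g T
  essSup_eq_one : essSup g volume = 1

/-! For `h < 1` the Gamma process satisfies `E exp (∫₀ᵀ h dS) = exp (-∫₀ᵀ log (1 - h(x)) dx)`: this
is the Gamma moment generating function when `h` is a step function, and the general case follows by
approximating `h` with its averages over the cells of a fine partition. Taking `h = -f / λ_T f`, the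
Laplace transform of `R_T(f)` at `1` is `exp (-1 + ∫₀ᵀ φ(f / λ_T f))` with
`φ(y) = y - log (1 + y) ≥ 0`, a convex function bounded by `y²` for `y ≥ 0`.

Hence the deficit `∫₀ᵀ φ(f / λ_T f)` tends to `0` both when `R_T(f) → 1` in probability and when
`v_T(f) → 0`. By Jensen's inequality on `(T - 1, T]` the fraction of the mass `λ_T f` lying in that
interval then tends to `0`, and as `f` is monotone this forces `b_T(f) → 0`. So the three hypotheses
all lead to `b_t(f) → 0`.

Let `m > 0` be the mean of `g` over a period `τ`. By monotonicity, `m` times the mass of `f` over an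
interval of length `τ` is at most the mass of `f g` over the next one, so
`λ_t(f g) ≥ m (λ_t f - τ f(t)) ≥ (m / 2) λ_t f` as soon as `b_t(f) ≤ 1 / (2 τ)`. With `g ≤ 1` almost
everywhere this gives the comparison of `v_t`, and shows that `k = f g` is bounded on `(0, t]` by
`f(t) = ρ λ_t k` with `ρ → 0`. Then `v_t(k) ≤ ρ`, and `-log (1 - x) ≤ x + 2 x²` bounds the moment
generating function of `R_t(k) - 1` at `±1 / (2 √ρ)` by `exp (1 / 2)`; every absolute moment of
`R_t(k) - 1` is therefore `O(√ρ ^ p)`.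
-/

section GammaDistribution

variable {a r : ℝ}

theorem integral_gammaMeasure (ha : 0 < a) (hr : 0 < r) (F : ℝ → ℝ) :
    ∫ x, F x ∂gammaMeasure a r =
      ∫ x in Ioi 0, r ^ a / Real.Gamma a * x ^ (a - 1) * Real.exp (-(r * x)) * F x := by
  have hmeas : Measurable (gammaPDF a r) := (measurable_gammaPDFReal a r).ennreal_ofReal
  rw [gammaMeasure, integral_withDensity_eq_integral_toReal_smul hmeas
      (ae_of_all _ fun _ => ENNReal.ofReal_lt_top), ← integral_Ici_eq_integral_Ioi,
    ← integral_indicator measurableSet_Ici]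
  refine integral_congr_ae (ae_of_all _ fun x => ?_)
  simp only [gammaPDF, ENNReal.toReal_ofReal (gammaPDFReal_nonneg ha hr x)]
  by_cases hx : 0 ≤ x <;> simp [gammaPDFReal, hx]

theorem integral_rpow_mul_exp_mul_gammaMeasure {s c : ℝ} (ha : 0 < a) (hr : 0 < r)
    (has : 0 < a + s) (hc : c < r) :
    ∫ x, x ^ s * Real.exp (c * x) ∂gammaMeasure a r =
      Real.Gamma (a + s) / Real.Gamma a * (r ^ a / (r - c) ^ (a + s)) := by
  have hmul : ∀ x ∈ Ioi (0 : ℝ),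
      r ^ a / Real.Gamma a * x ^ (a - 1) * Real.exp (-(r * x)) * (x ^ s * Real.exp (c * x)) =
        r ^ a / Real.Gamma a * (x ^ (a + s - 1) * Real.exp (-((r - c) * x))) := by
    intro x (hx : 0 < x)
    rw [show a + s - 1 = (a - 1) + s by ring, Real.rpow_add hx,
      show -((r - c) * x) = -(r * x) + c * x by ring, Real.exp_add]
    ring
  rw [integral_gammaMeasure ha hr, setIntegral_congr_fun measurableSet_Ioi hmul,
    integral_const_mul, Real.integral_rpow_mul_exp_neg_mul_Ioi has (sub_pos.2 hc),
    Real.div_rpow zero_le_one (sub_pos.2 hc).le, Real.one_rpow]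
  ring

theorem integral_id_gammaMeasure (ha : 0 < a) (hr : 0 < r) :
    ∫ x, x ∂gammaMeasure a r = a / r := by
  have := integral_rpow_mul_exp_mul_gammaMeasure (s := 1) ha hr (by linarith) hr
  have hG := (Real.Gamma_pos_of_pos ha).ne'
  have hra := (Real.rpow_pos_of_pos hr a).ne'
  simp only [Real.rpow_one, zero_mul, Real.exp_zero, mul_one, sub_zero, Real.rpow_add_one hr.ne',
    Real.Gamma_add_one ha.ne'] at this
  rw [this]
  field_simp

theorem mgf_id_gammaMeasure {c : ℝ} (ha : 0 < a) (hr : 0 < r) (hc : c < r) :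
    mgf id (gammaMeasure a r) c = (r / (r - c)) ^ a := by
  have := integral_rpow_mul_exp_mul_gammaMeasure (s := 0) ha hr (by linarith) hc
  have hG := (Real.Gamma_pos_of_pos ha).ne'
  simpa [mgf, hG, Real.div_rpow hr.le (sub_pos.2 hc).le] using this

end GammaDistribution

namespace GammaProcess

variable {Ω : Type*} [MeasurableSpace Ω] {P : Measure Ω}

theorem measurable_path_sub (S : GammaProcess P) (s t : ℝ) :
    Measurable fun ω => S.path ω t - S.path ω s :=
  (S.measurable_toFun t.toNNReal).sub (S.measurable_toFun s.toNNReal)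

theorem map_path_sub (S : GammaProcess P) {s t : ℝ} (hs : 0 ≤ s) (hst : s < t) :
    P.map (fun ω => S.path ω t - S.path ω s) = gammaMeasure (t - s) 1 := by
  have := S.law s.toNNReal t.toNNReal ((Real.toNNReal_lt_toNNReal_iff (hs.trans_lt hst)).2 hst)
  rwa [Real.coe_toNNReal _ hs, Real.coe_toNNReal _ (hs.trans hst.le)] at this

theorem integral_path_sub (S : GammaProcess P) {s t : ℝ} (hs : 0 ≤ s) (hst : s < t) :
    ∫ ω, (S.path ω t - S.path ω s) ∂P = t - s := by
  rw [← div_one (t - s), ← integral_id_gammaMeasure (sub_pos.2 hst) one_pos,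
    ← S.map_path_sub hs hst]
  exact (integral_map (S.measurable_path_sub s t).aemeasurable
    measurable_id.aestronglyMeasurable).symm

theorem mgf_path_sub (S : GammaProcess P) {s t c : ℝ} (hs : 0 ≤ s) (hst : s < t) (hc : c < 1) :
    mgf (fun ω => S.path ω t - S.path ω s) P c = Real.exp (-Real.log (1 - c) * (t - s)) := by
  rw [← mgf_id_map (S.measurable_path_sub s t).aemeasurable,
    S.map_path_sub hs hst, mgf_id_gammaMeasure (sub_pos.2 hst) one_pos hc,
    Real.rpow_def_of_pos (one_div_pos.2 (sub_pos.2 hc)), one_div, Real.log_inv]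

theorem integral_exp_sum_mul_path_sub (S : GammaProcess P) {τ : ℕ → ℝ} (hτ : StrictMono τ)
    (h0 : 0 ≤ τ 0) {c : ℕ → ℝ} (hc : ∀ i, c i < 1) (n : ℕ) :
    ∫ ω, Real.exp (∑ i ∈ Finset.range n, c i * (S.path ω (τ (i + 1)) - S.path ω (τ i))) ∂P =
      Real.exp (∑ i ∈ Finset.range n, -Real.log (1 - c i) * (τ (i + 1) - τ i)) := by
  let X : ℕ → Ω → ℝ := fun i ω => c i * (S.path ω (τ (i + 1)) - S.path ω (τ i))
  have hX : ∀ i, Measurable (X i) := fun i =>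
    (S.measurable_path_sub _ _).const_mul _
  have hind : iIndepFun X P :=
    (S.indep.nat (t := fun i => (τ i).toNNReal)
      fun i j hij => Real.toNNReal_mono (hτ.monotone hij)).comp (fun i x => c i * x)
      fun i => measurable_const_mul (c i)
  have hmgf : ∀ i, mgf (X i) P 1 = Real.exp (-Real.log (1 - c i) * (τ (i + 1) - τ i)) := by
    intro i
    rw [mgf_const_mul, mul_one, S.mgf_path_sub (h0.trans (hτ.monotone (Nat.zero_le i)))
      (hτ (Nat.lt_succ_self i)) (hc i)]
  have hsum := hind.mgf_sum (t := 1) hX (Finset.range n)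
  simp only [hmgf, ← Real.exp_sum] at hsum
  simpa only [mgf, one_mul, Finset.sum_apply] using hsum

/-- The Lebesgue-Stieltjes measure of a path, restricted to `(0, T]`: the random measure against
which `GammaProcess.integral` integrates. -/
noncomputable def jumpMeasure (S : GammaProcess P) (T : ℝ) (ω : Ω) : Measure ℝ :=
  (S.path ω).measure.restrict (Ioc 0 T)

theorem integral_eq (S : GammaProcess P) (h : ℝ → ℝ) (T : ℝ) (ω : Ω) :
    S.integral h T ω = ∫ x, h x ∂S.jumpMeasure T ω := rfl

theorem jumpMeasure_Ioc (S : GammaProcess P) (T a b : ℝ) (ω : Ω) :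
    S.jumpMeasure T ω (Ioc a b) = ENNReal.ofReal (S.path ω (min b T) - S.path ω (max a 0)) := by
  rw [jumpMeasure, Measure.restrict_apply measurableSet_Ioc, Ioc_inter_Ioc,
    StieltjesFunction.measure_Ioc]

theorem jumpMeasure_univ (S : GammaProcess P) (T : ℝ) (ω : Ω) :
    S.jumpMeasure T ω univ = ENNReal.ofReal (S.path ω T - S.path ω 0) := by
  rw [jumpMeasure, Measure.restrict_apply_univ, StieltjesFunction.measure_Ioc]

instance (S : GammaProcess P) (T : ℝ) (ω : Ω) : IsFiniteMeasure (S.jumpMeasure T ω) :=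
  ⟨by simp [jumpMeasure_univ]⟩

theorem measurable_jumpMeasure (S : GammaProcess P) (T : ℝ) : Measurable (S.jumpMeasure T) := by
  refine Measurable.measure_of_isPiSystem
    ((borel_eq_generateFrom_Ioc ℝ ▸ BorelSpace.measurable_eq :
      _ = MeasurableSpace.generateFrom {s : Set ℝ | ∃ l u, l < u ∧ Ioc l u = s}))
    (isPiSystem_Ioc id id) ?_ ?_
  · rintro _ ⟨l, u, -, rfl⟩
    simp only [jumpMeasure_Ioc]
    exact (S.measurable_path_sub _ _).ennreal_ofReal
  · simp only [jumpMeasure_univ]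
    exact (S.measurable_path_sub _ _).ennreal_ofReal

theorem bind_jumpMeasure (S : GammaProcess P) (T : ℝ) :
    P.bind (S.jumpMeasure T) = volume.restrict (Ioc 0 T) := by
  refine (Measure.ext_of_Ioc _ _ fun a b _ => ?_).symm
  rw [Measure.bind_apply measurableSet_Ioc (S.measurable_jumpMeasure T).aemeasurable,
    Measure.restrict_apply measurableSet_Ioc, Ioc_inter_Ioc, Real.volume_Ioc]
  simp only [jumpMeasure_Ioc]
  rcases le_or_gt (min b T) (max a 0) with h | h
  · rw [ENNReal.ofReal_of_nonpos (sub_nonpos.2 h)]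
    simp [ENNReal.ofReal_of_nonpos (sub_nonpos.2 ((S.path _).mono h))]
  · have hint := S.integral_path_sub (le_max_right a 0) h
    rw [← hint, ofReal_integral_eq_lintegral_ofReal]
    · exact .of_integral_ne_zero (hint.trans_ne (sub_pos.2 h).ne')
    · exact ae_of_all _ fun ω => sub_nonneg.2 ((S.path ω).mono h.le)

theorem ae_ae_jumpMeasure (S : GammaProcess P) (T : ℝ) {p : ℝ → Prop}
    (hp : ∀ᵐ x ∂volume.restrict (Ioc 0 T), p x) : ∀ᵐ ω ∂P, ∀ᵐ x ∂S.jumpMeasure T ω, p x := by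
  rw [← S.bind_jumpMeasure T] at hp
  exact Measure.ae_ae_of_ae_bind (S.measurable_jumpMeasure T).aemeasurable hp

theorem aemeasurable_integral (S : GammaProcess P) {T : ℝ} {h : ℝ → ℝ}
    (hh : AEMeasurable h (volume.restrict (Ioc 0 T))) : AEMeasurable (S.integral h T) P := by
  let κ : Kernel Ω ℝ := ⟨S.jumpMeasure T, S.measurable_jumpMeasure T⟩
  refine ⟨fun ω => ∫ x, hh.mk h x ∂S.jumpMeasure T ω,
    (hh.measurable_mk.stronglyMeasurable.integral_kernel (κ := κ)).measurable, ?_⟩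
  filter_upwards [S.ae_ae_jumpMeasure T hh.ae_eq_mk] with ω hω using integral_congr_ae hω

end GammaProcess

section StepFunctions

theorem natCeil_div_of_mem_Ioc {δ x : ℝ} (hδ : 0 < δ) {i : ℕ}
    (hx : x ∈ Ioc (i * δ) ((i + 1 : ℕ) * δ)) : ⌈x / δ⌉₊ = i + 1 := by
  rw [Nat.ceil_eq_iff (Nat.succ_ne_zero i)]
  simpa [lt_div_iff₀ hδ, div_le_iff₀ hδ] using hx

theorem measurable_natCeil_div (δ : ℝ) : Measurable fun x : ℝ => ⌈x / δ⌉₊ :=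
  Nat.measurable_ceil.comp (measurable_id.div_const δ)

theorem setIntegral_comp_natCeil_div (μ : Measure ℝ) [IsLocallyFiniteMeasure μ] {δ : ℝ}
    (hδ : 0 < δ) (c : ℕ → ℝ) (n : ℕ) :
    ∫ x in Ioc 0 (n * δ), c ⌈x / δ⌉₊ ∂μ =
      ∑ i ∈ Finset.range n, c (i + 1) * μ.real (Ioc (i * δ) ((i + 1 : ℕ) * δ)) := by
  have hle : ∀ i : ℕ, i * δ ≤ (i + 1 : ℕ) * δ := fun i => by gcongr; exact i.le_succ
  have hcell : ∀ i : ℕ, EqOn (fun x => c ⌈x / δ⌉₊) (fun _ => c (i + 1))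
      (Ioc (i * δ) ((i + 1 : ℕ) * δ)) :=
    fun i x hx => by simp only [natCeil_div_of_mem_Ioc hδ hx]
  have hsum := intervalIntegral.sum_integral_adjacent_intervals (μ := μ)
    (f := fun x => c ⌈x / δ⌉₊) (a := fun i : ℕ => i * δ) (n := n) fun i _ => by
      rw [intervalIntegrable_iff_integrableOn_Ioc_of_le (hle i),
        integrableOn_congr_fun (hcell i) measurableSet_Ioc]
      exact integrableOn_const measure_Ioc_lt_top.ne
  simp only [Nat.cast_zero, zero_mul] at hsum
  rw [← intervalIntegral.integral_of_le (by positivity), ← hsum]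
  refine Finset.sum_congr rfl fun i _ => ?_
  rw [intervalIntegral.integral_of_le (hle i), setIntegral_congr_fun measurableSet_Ioc (hcell i),
    setIntegral_const, smul_eq_mul, mul_comm]

/-- The average of `h` over the `i`-th cell `[(i - 1) δ, i δ]` of the partition of mesh `δ`, written
as a closed ball so that Lebesgue's differentiation theorem applies as it stands. -/
noncomputable def cellAverage (h : ℝ → ℝ) (δ : ℝ) (i : ℕ) : ℝ :=
  ⨍ y in Metric.closedBall ((i - 1 / 2) * δ) (δ / 2), h y

theorem cellAverage_mem_Icc {h : ℝ → ℝ} {A B δ : ℝ} (hh : Measurable h)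
    (hAB : ∀ x, h x ∈ Icc A B) (hδ : 0 < δ) (i : ℕ) : cellAverage h δ i ∈ Icc A B := by
  have : IsFiniteMeasure (volume.restrict (Metric.closedBall ((i - 1 / 2) * δ) (δ / 2))) :=
    ⟨by simp [ENNReal.mul_lt_top]⟩
  refine (convex_Icc A B).set_average_mem isClosed_Icc ?_ measure_closedBall_lt_top.ne
    (ae_of_all _ hAB) (Integrable.of_mem_Icc A B hh.aemeasurable (ae_of_all _ hAB))
  simpa [Real.volume_closedBall] using hδ

theorem ae_tendsto_cellAverage {h : ℝ → ℝ} (hh : LocallyIntegrable h) {δ : ℕ → ℝ}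
    (hδ : Tendsto δ atTop (𝓝[>] 0)) :
    ∀ᵐ x, 0 < x → Tendsto (fun n => cellAverage h (δ n) ⌈x / δ n⌉₊) atTop (𝓝 (h x)) := by
  filter_upwards [IsUnifLocDoublingMeasure.ae_tendsto_average volume hh 1] with x hx hx0
  refine hx _ (fun n => δ n / 2) ?_ ?_
  · simpa [div_eq_mul_inv] using TendstoNhdsWithinIoi.mul_const (b := (2⁻¹ : ℝ)) (by norm_num) hδ
  · filter_upwards [hδ self_mem_nhdsWithin] with n (hn : 0 < δ n)
    have h1 := (div_le_iff₀ hn).1 (Nat.le_ceil (x / δ n))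
    have h2 := mul_lt_mul_of_pos_right (Nat.ceil_lt_add_one (div_pos hx0 hn).le) hn
    rw [add_mul, div_mul_cancel₀ _ hn.ne'] at h2
    rw [Metric.mem_closedBall, Real.dist_eq, abs_le]
    constructor <;> linarith

theorem exists_tendsto_comp_natCeil_div {T A B : ℝ} (hT : 0 < T) {h : ℝ → ℝ}
    (hh : AEMeasurable h (volume.restrict (Ioc 0 T)))
    (hAB : ∀ᵐ x ∂volume.restrict (Ioc 0 T), h x ∈ Icc A B) :
    ∃ c : ℕ → ℕ → ℝ, (∀ n i, c n i ∈ Icc A B) ∧ ∀ᵐ x ∂volume.restrict (Ioc 0 T),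
      Tendsto (fun n => c n ⌈x / (T / (n + 1 : ℕ))⌉₊) atTop (𝓝 (h x)) := by
  have : (ae (volume.restrict (Ioc 0 T))).NeBot := by
    rw [ae_neBot, Ne, Measure.restrict_eq_zero]
    simpa using hT
  obtain ⟨x, hx⟩ := hAB.exists
  have hle : A ≤ B := hx.1.trans hx.2
  let u : ℝ → ℝ := fun x => max A (min B (hh.mk h x))
  have hu : Measurable u := measurable_const.max (measurable_const.min hh.measurable_mk)
  have huAB : ∀ x, u x ∈ Icc A B := fun x => ⟨le_max_left _ _, max_le hle (min_le_left _ _)⟩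
  have huh : ∀ᵐ x ∂volume.restrict (Ioc 0 T), u x = h x := by
    filter_upwards [hh.ae_eq_mk, hAB] with x hx hxAB
    simp only [u, ← hx, min_eq_right hxAB.2, max_eq_right hxAB.1]
  have huloc : LocallyIntegrable u :=
    (locallyIntegrable_const (max |A| |B|)).mono hu.aestronglyMeasurable
      (ae_of_all _ fun x => (abs_le_max_abs_abs (huAB x).1 (huAB x).2).trans (le_abs_self _))
  have hδ : ∀ n : ℕ, 0 < T / (n + 1 : ℕ) := fun n => by positivity
  have hδlim : Tendsto (fun n : ℕ => T / (n + 1 : ℕ)) atTop (𝓝[>] 0) :=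
    tendsto_nhdsWithin_iff.2 ⟨(tendsto_const_div_atTop_nhds_zero_nat T).comp
      (tendsto_add_atTop_nat 1), Eventually.of_forall hδ⟩
  refine ⟨fun n => cellAverage u (T / (n + 1 : ℕ)),
    fun n => cellAverage_mem_Icc hu huAB (hδ n), ?_⟩
  filter_upwards [huh, ae_restrict_of_ae (ae_tendsto_cellAverage huloc hδlim),
    ae_restrict_mem measurableSet_Ioc] with x hxh hx hxT
  simpa only [hxh] using hx hxT.1

end StepFunctions

namespace GammaProcess

variable {Ω : Type*} [MeasurableSpace Ω] {P : Measure Ω}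

theorem integral_exp_integral_comp_natCeil_div (S : GammaProcess P) {δ : ℝ} (hδ : 0 < δ)
    {c : ℕ → ℝ} (hc : ∀ i, c i < 1) (n : ℕ) :
    ∫ ω, Real.exp (S.integral (fun x => c ⌈x / δ⌉₊) (n * δ) ω) ∂P =
      Real.exp (∫ x in Ioc 0 (n * δ), -Real.log (1 - c ⌈x / δ⌉₊)) := by
  have hmono : StrictMono fun i : ℕ => i * δ := fun i j hij => by
    simpa [hδ] using hij
  have hstep := S.integral_exp_sum_mul_path_sub hmono (by simp) (fun i => hc (i + 1)) n
  have hlen : ∀ i : ℕ, i * δ ≤ (i + 1 : ℕ) * δ := fun i => hmono.monotone i.le_succ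
  rw [setIntegral_comp_natCeil_div volume hδ fun i => -Real.log (1 - c i)]
  simp only [integral, setIntegral_comp_natCeil_div _ hδ c, Measure.real,
    StieltjesFunction.measure_Ioc, Real.volume_Ioc,
    ENNReal.toReal_ofReal (sub_nonneg.2 (hlen _)),
    ENNReal.toReal_ofReal (sub_nonneg.2 ((S.path _).mono (hlen _)))]
  exact hstep

theorem integrable_exp_mul_path (S : GammaProcess P) {T c : ℝ} (hT : 0 < T) (hc : c < 1) :
    Integrable (fun ω => Real.exp (c * (S.path ω T - S.path ω 0))) P :=
  .of_integral_ne_zero <| by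
    simpa only [mgf] using ((S.mgf_path_sub le_rfl hT hc).trans_ne (Real.exp_pos _).ne')

theorem jumpMeasure_real_univ (S : GammaProcess P) {T : ℝ} (hT : 0 ≤ T) (ω : Ω) :
    (S.jumpMeasure T ω).real univ = S.path ω T - S.path ω 0 := by
  rw [Measure.real, jumpMeasure_univ, ENNReal.toReal_ofReal (sub_nonneg.2 ((S.path ω).mono hT))]

theorem tendsto_integral_exp_integral (S : GammaProcess P) {T A B : ℝ} (hT : 0 < T) (hB : B < 1)
    {u : ℕ → ℝ → ℝ} {h : ℝ → ℝ} (hu : ∀ n, Measurable (u n)) (huAB : ∀ n x, u n x ∈ Icc A B)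
    (hlim : ∀ᵐ x ∂volume.restrict (Ioc 0 T), Tendsto (fun n => u n x) atTop (𝓝 (h x))) :
    Tendsto (fun n => ∫ ω, Real.exp (S.integral (u n) T ω) ∂P) atTop
      (𝓝 (∫ ω, Real.exp (S.integral h T ω) ∂P)) := by
  have hbound : ∀ n x, ‖u n x‖ ≤ max |A| |B| := fun n x =>
    abs_le_max_abs_abs (huAB n x).1 (huAB n x).2
  refine tendsto_integral_of_dominated_convergence
    (fun ω => Real.exp (max B 0 * (S.path ω T - S.path ω 0)))
    (fun n => (Real.measurable_exp.comp_aemeasurable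
      (S.aemeasurable_integral (hu n).aemeasurable)).aestronglyMeasurable)
    (S.integrable_exp_mul_path hT (max_lt hB one_pos)) (fun n => ae_of_all _ fun ω => ?_) ?_
  · rw [Real.norm_eq_abs, Real.abs_exp, Real.exp_le_exp]
    calc S.integral (u n) T ω = ∫ x, u n x ∂S.jumpMeasure T ω := S.integral_eq _ _ _
      _ ≤ ∫ _, max B 0 ∂S.jumpMeasure T ω :=
          integral_mono (Integrable.of_mem_Icc A B (hu n).aemeasurable (ae_of_all _ (huAB n)))
            (integrable_const _) fun x => (huAB n x).2.trans (le_max_left _ _)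
      _ = max B 0 * (S.path ω T - S.path ω 0) := by
          rw [integral_const, S.jumpMeasure_real_univ hT.le, smul_eq_mul, mul_comm]
  · filter_upwards [S.ae_ae_jumpMeasure T hlim] with ω hω
    simp only [integral_eq]
    refine (Real.continuous_exp.tendsto _).comp ?_
    exact tendsto_integral_of_dominated_convergence (fun _ => max |A| |B|)
      (fun n => (hu n).aestronglyMeasurable) (integrable_const _)
      (fun n => ae_of_all _ (hbound n)) hω

theorem integral_exp_integral (S : GammaProcess P) {T A B : ℝ} (hT : 0 < T) (hB : B < 1)
    {h : ℝ → ℝ} (hh : AEMeasurable h (volume.restrict (Ioc 0 T)))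
    (hAB : ∀ᵐ x ∂volume.restrict (Ioc 0 T), h x ∈ Icc A B) :
    ∫ ω, Real.exp (S.integral h T ω) ∂P = Real.exp (∫ x in Ioc 0 T, -Real.log (1 - h x)) := by
  obtain ⟨c, hcAB, hlim⟩ := exists_tendsto_comp_natCeil_div hT hh hAB
  let δ : ℕ → ℝ := fun n => T / (n + 1 : ℕ)
  have hδ : ∀ n, 0 < δ n := fun n => by positivity
  have hδT : ∀ n, (n + 1 : ℕ) * δ n = T := fun n => by simp only [δ]; field_simp
  have hmeas : ∀ n, Measurable fun x => c n ⌈x / δ n⌉₊ := fun n =>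
    (measurable_from_top (f := c n)).comp (measurable_natCeil_div (δ n))
  have hstep : ∀ n, ∫ ω, Real.exp (S.integral (fun x => c n ⌈x / δ n⌉₊) T ω) ∂P =
      Real.exp (∫ x in Ioc 0 T, -Real.log (1 - c n ⌈x / δ n⌉₊)) := fun n => by
    simpa only [hδT] using S.integral_exp_integral_comp_natCeil_div (hδ n)
      (fun i => (hcAB n i).2.trans_lt hB) (n + 1)
  refine tendsto_nhds_unique
    (S.tendsto_integral_exp_integral hT hB hmeas (fun n x => hcAB n _) hlim) ?_
  simp only [hstep]
  refine (Real.continuous_exp.tendsto _).comp (tendsto_integral_of_dominated_convergence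
    (fun _ => max |Real.log (1 - B)| |Real.log (1 - A)|)
    (fun n => (Real.measurable_log.comp ((hmeas n).const_sub 1)).neg.aestronglyMeasurable)
    (integrable_const _) (fun n => ae_of_all _ fun x => ?_) ?_)
  · rw [norm_neg]
    obtain ⟨hA, hB'⟩ := hcAB n ⌈x / δ n⌉₊
    exact abs_le_max_abs_abs (Real.log_le_log (by linarith) (by linarith))
      (Real.log_le_log (by linarith) (by linarith))
  · filter_upwards [hlim, hAB] with x hx hxAB
    exact ((hx.const_sub 1).log (by linarith [hxAB.2])).neg

end GammaProcess

section Cumulative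

variable {k : ℝ → ℝ} {T M : ℝ}

theorem cumul_eq_setIntegral (k : ℝ → ℝ) (hT : 0 ≤ T) : cumul k T = ∫ x in Ioc 0 T, k x :=
  intervalIntegral.integral_of_le hT

theorem pos_of_cumul_pos (hT : 0 ≤ T) (hkM : ∀ᵐ x ∂volume.restrict (Ioc 0 T), k x ∈ Icc 0 M)
    (hpos : 0 < cumul k T) : 0 < M := by
  by_contra! hM
  refine hpos.not_ge ((cumul_eq_setIntegral k hT).trans_le (integral_nonpos_of_ae ?_))
  filter_upwards [hkM] with x hx using hx.2.trans hM

theorem vChar_le_div_cumul (hT : 0 ≤ T) (hk : AEMeasurable k (volume.restrict (Ioc 0 T)))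
    (hkM : ∀ᵐ x ∂volume.restrict (Ioc 0 T), k x ∈ Icc 0 M) : vChar k T ≤ M / cumul k T := by
  have hsq : cumul (fun x => k x ^ 2) T ≤ M * cumul k T := by
    rw [cumul_eq_setIntegral _ hT, cumul_eq_setIntegral _ hT, ← integral_const_mul]
    refine integral_mono_of_nonneg (ae_of_all _ fun x => sq_nonneg (k x))
      ((Integrable.of_mem_Icc 0 M hk hkM).const_mul M) ?_
    filter_upwards [hkM] with x hx
    simpa only [sq] using mul_le_mul_of_nonneg_right hx.2 hx.1
  rcases eq_or_ne (cumul k T) 0 with h0 | h0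
  · simp [vChar, h0]
  · calc vChar k T ≤ M * cumul k T / cumul k T ^ 2 := by
          unfold vChar; gcongr
      _ = M / cumul k T := by field_simp

end Cumulative

theorem ae_div_cumul_mul_mem_Icc {k : ℝ → ℝ} {T M θ : ℝ} (hpos : 0 < cumul k T)
    (hkM : ∀ᵐ x ∂volume.restrict (Ioc 0 T), k x ∈ Icc 0 M) (hθ : |θ| * (M / cumul k T) ≤ 1 / 2) :
    ∀ᵐ x ∂volume.restrict (Ioc 0 T), θ / cumul k T * k x ∈ Icc (-(1 / 2)) (1 / 2) := by
  filter_upwards [hkM] with x hx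
  refine abs_le.1 ?_
  calc |θ / cumul k T * k x| = |θ| * (k x / cumul k T) := by
        rw [abs_mul, abs_div, abs_of_pos hpos, abs_of_nonneg hx.1, div_mul_eq_mul_div,
          mul_div_assoc]
    _ ≤ |θ| * (M / cumul k T) := by gcongr; exact hx.2
    _ ≤ 1 / 2 := hθ

theorem neg_log_one_sub_le {x : ℝ} (hx : |x| ≤ 1 / 2) : -Real.log (1 - x) ≤ x + 2 * x ^ 2 := by
  have htaylor := (abs_le.1
    (Real.abs_log_sub_add_sum_range_le (hx.trans_lt (by norm_num)) 1)).1
  have hquot : x ^ 2 / (1 - |x|) ≤ 2 * x ^ 2 := by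
    rw [div_le_iff₀ (by linarith)]
    nlinarith [sq_nonneg x]
  norm_num at htaylor
  linarith

theorem eLpNorm_le_rpow_mgf_add_mgf {Ω : Type*} [MeasurableSpace Ω] {μ : Measure Ω} {X : Ω → ℝ}
    {t : ℝ} {p : ℝ≥0} (hp : p ≠ 0) (ht : 0 < t) (hX : AEMeasurable X μ)
    (hpos : Integrable (fun ω => Real.exp (t * X ω)) μ)
    (hneg : Integrable (fun ω => Real.exp (-t * X ω)) μ) :
    eLpNorm X p μ ≤ ENNReal.ofReal (p / t * (mgf X μ t + mgf X μ (-t)) ^ (p : ℝ)⁻¹) := by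
  have hmoment : ∫ ω, ‖X ω‖ ^ (p : ℝ) ∂μ ≤ (p / t) ^ (p : ℝ) * (mgf X μ t + mgf X μ (-t)) := by
    rw [mgf, mgf, ← integral_add hpos hneg, ← integral_const_mul]
    refine integral_mono_of_nonneg (ae_of_all _ fun ω => by positivity)
      ((hpos.add hneg).const_mul _) (ae_of_all _ fun ω => ?_)
    refine (rpow_abs_le_mul_max_exp_of_pos (X ω) p.coe_nonneg ht).trans ?_
    exact mul_le_mul_of_nonneg_left
      (max_le_add_of_nonneg (Real.exp_pos _).le (Real.exp_pos _).le) (by positivity)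
  have hLp : MemLp X p μ := (integrable_norm_rpow_iff hX.aestronglyMeasurable (by simpa using hp)
    ENNReal.coe_ne_top).1 (integrable_rpow_abs_of_integrable_exp_mul ht.ne' hpos hneg p.coe_nonneg)
  rw [hLp.eLpNorm_eq_integral_rpow_norm (by simpa using hp) ENNReal.coe_ne_top,
    ENNReal.coe_toReal]
  refine ENNReal.ofReal_le_ofReal ?_
  calc (∫ ω, ‖X ω‖ ^ (p : ℝ) ∂μ) ^ (p : ℝ)⁻¹
      ≤ ((p / t) ^ (p : ℝ) * (mgf X μ t + mgf X μ (-t))) ^ (p : ℝ)⁻¹ := by gcongr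
    _ = p / t * (mgf X μ t + mgf X μ (-t)) ^ (p : ℝ)⁻¹ := by
      rw [Real.mul_rpow (by positivity) (add_nonneg mgf_nonneg mgf_nonneg),
        Real.rpow_rpow_inv (by positivity) (by simpa using hp)]

namespace GammaProcess

variable {Ω : Type*} [MeasurableSpace Ω] {P : Measure Ω}

/-- The normalised Gamma integral `R_t(h) = (∫₀ᵗ h dS) / λ_t h`. -/
noncomputable def ratio (S : GammaProcess P) (h : ℝ → ℝ) (t : ℝ) (ω : Ω) : ℝ :=
  S.integral h t ω / cumul h t

theorem integral_const_mul (S : GammaProcess P) (c : ℝ) (h : ℝ → ℝ) (t : ℝ) (ω : Ω) :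
    S.integral (fun x => c * h x) t ω = c * S.integral h t ω :=
  MeasureTheory.integral_const_mul c h

theorem aemeasurable_ratio (S : GammaProcess P) {T : ℝ} {h : ℝ → ℝ}
    (hh : AEMeasurable h (volume.restrict (Ioc 0 T))) : AEMeasurable (S.ratio h T) P :=
  (S.aemeasurable_integral hh).div_const _

theorem mgf_ratio (S : GammaProcess P) {T A B θ : ℝ} (hT : 0 < T) (hB : B < 1) {h : ℝ → ℝ}
    (hh : AEMeasurable h (volume.restrict (Ioc 0 T)))
    (hAB : ∀ᵐ x ∂volume.restrict (Ioc 0 T), θ / cumul h T * h x ∈ Icc A B) :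
    mgf (S.ratio h T) P θ =
      Real.exp (∫ x in Ioc 0 T, -Real.log (1 - θ / cumul h T * h x)) := by
  rw [← S.integral_exp_integral hT hB (hh.const_mul _) hAB, mgf]
  simp only [S.integral_const_mul, ratio]
  simp only [mul_div_assoc', div_mul_eq_mul_div]

section BoundedIntegrand

variable (S : GammaProcess P) {k : ℝ → ℝ} {T M : ℝ} (hT : 0 < T)
  (hk : AEMeasurable k (volume.restrict (Ioc 0 T)))
  (hkM : ∀ᵐ x ∂volume.restrict (Ioc 0 T), k x ∈ Icc 0 M) (hpos : 0 < cumul k T)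
include hT hk hkM hpos

theorem mgf_ratio_le {θ : ℝ} (hθ : |θ| * (M / cumul k T) ≤ 1 / 2) :
    mgf (S.ratio k T) P θ ≤ Real.exp (θ + 2 * θ ^ 2 * vChar k T) := by
  have hmem := ae_div_cumul_mul_mem_Icc hpos hkM hθ
  have hint : Integrable k (volume.restrict (Ioc 0 T)) := Integrable.of_mem_Icc 0 M hk hkM
  have hsqint : Integrable (fun x => k x ^ 2) (volume.restrict (Ioc 0 T)) := by
    refine Integrable.of_mem_Icc 0 (M ^ 2) (hk.pow_const 2) ?_
    filter_upwards [hkM] with x hx using ⟨sq_nonneg _, pow_le_pow_left₀ hx.1 hx.2 2⟩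
  rw [S.mgf_ratio hT (by norm_num) hk hmem, Real.exp_le_exp]
  calc ∫ x in Ioc 0 T, -Real.log (1 - θ / cumul k T * k x)
      ≤ ∫ x in Ioc 0 T, (θ / cumul k T * k x + 2 * (θ / cumul k T) ^ 2 * k x ^ 2) := by
        refine integral_mono_ae ?_ ((hint.const_mul _).add (hsqint.const_mul _)) ?_
        · refine Integrable.of_mem_Icc (-Real.log (1 + 1 / 2)) (-Real.log (1 - 1 / 2))
            (Real.measurable_log.comp_aemeasurable ((hk.const_mul _).const_sub 1)).neg ?_
          filter_upwards [hmem] with x ⟨hl, hu⟩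
          exact ⟨neg_le_neg (Real.log_le_log (by linarith) (by linarith)),
            neg_le_neg (Real.log_le_log (by norm_num) (by linarith))⟩
        · filter_upwards [hmem] with x hx
          exact (neg_log_one_sub_le (abs_le.2 hx)).trans_eq (by ring)
    _ = θ / cumul k T * cumul k T +
          2 * (θ / cumul k T) ^ 2 * cumul (fun x => k x ^ 2) T := by
        rw [integral_add (hint.const_mul _) (hsqint.const_mul _), MeasureTheory.integral_const_mul,
          MeasureTheory.integral_const_mul, cumul_eq_setIntegral _ hT.le,
          cumul_eq_setIntegral _ hT.le]
    _ = θ + 2 * θ ^ 2 * vChar k T := by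
        rw [vChar]
        field_simp

theorem integrable_exp_mul_ratio_sub_one {θ : ℝ} (hθ : |θ| * (M / cumul k T) ≤ 1 / 2) :
    Integrable (fun ω => Real.exp (θ * (S.ratio k T ω - 1))) P := by
  have hmgf := S.mgf_ratio hT (by norm_num) hk (ae_div_cumul_mul_mem_Icc hpos hkM hθ)
  have hexp : Integrable (fun ω => Real.exp (θ * S.ratio k T ω)) P :=
    .of_integral_ne_zero (hmgf.trans_ne (Real.exp_pos _).ne')
  simpa only [mul_sub, Real.exp_sub] using hexp.div_const _

theorem mgf_ratio_sub_one_le {θ : ℝ} (hθ : |θ| * (M / cumul k T) ≤ 1 / 2) :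
    mgf (fun ω => S.ratio k T ω - 1) P θ ≤ Real.exp (2 * θ ^ 2 * vChar k T) := by
  simp only [sub_eq_add_neg, mgf_add_const, mul_neg, mul_one]
  calc mgf (S.ratio k T) P θ * Real.exp (-θ)
      ≤ Real.exp (θ + 2 * θ ^ 2 * vChar k T) * Real.exp (-θ) := by
        gcongr
        exact S.mgf_ratio_le hT hk hkM hpos hθ
    _ = Real.exp (2 * θ ^ 2 * vChar k T) := by
        rw [← Real.exp_add]
        ring_nf

theorem eLpNorm_ratio_sub_one_le {p : ℝ≥0} (hp : p ≠ 0) (hM : M ≤ cumul k T) :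
    eLpNorm (fun ω => S.ratio k T ω - 1) p P ≤
      ENNReal.ofReal (2 * p * √(M / cumul k T) * (2 * Real.exp (1 / 2)) ^ (p : ℝ)⁻¹) := by
  have hvρ : vChar k T ≤ M / cumul k T := vChar_le_div_cumul hT.le hk hkM
  set ρ := M / cumul k T
  have hρ : 0 < ρ := div_pos (pos_of_cumul_pos hT.le hkM hpos) hpos
  have hρ1 : √ρ ≤ 1 := Real.sqrt_le_one.2 ((div_le_one hpos).2 hM)
  have hsq : √ρ ^ 2 = ρ := Real.sq_sqrt hρ.le
  have hρ' : 0 < √ρ := Real.sqrt_pos.2 hρ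
  -- `θ = 1 / (2 √ρ)` is the largest order of magnitude for which `θ ^ 2 * vChar k T` stays bounded.
  let θ := 1 / (2 * √ρ)
  have hθ0 : 0 < θ := by positivity
  have hθ : |θ| * ρ ≤ 1 / 2 := by
    rw [abs_of_pos hθ0, div_mul_eq_mul_div, div_le_iff₀ (by positivity)]
    nlinarith
  have hθ2 : 2 * θ ^ 2 * vChar k T ≤ 1 / 2 := calc
    2 * θ ^ 2 * vChar k T ≤ 2 * θ ^ 2 * √ρ ^ 2 := by rw [hsq]; gcongr
    _ = 1 / 2 := by simp only [θ]; field_simp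
  have hpos_le := S.mgf_ratio_sub_one_le hT hk hkM hpos hθ
  have hneg_le := S.mgf_ratio_sub_one_le hT hk hkM hpos (θ := -θ) (by rwa [abs_neg])
  rw [neg_sq] at hneg_le
  refine (eLpNorm_le_rpow_mgf_add_mgf hp hθ0 ((S.aemeasurable_ratio hk).sub_const 1)
    (S.integrable_exp_mul_ratio_sub_one hT hk hkM hpos hθ)
    (S.integrable_exp_mul_ratio_sub_one hT hk hkM hpos (by rwa [abs_neg]))).trans
    (ENNReal.ofReal_le_ofReal ?_)
  rw [show p / θ = 2 * p * √ρ by simp only [θ]; field_simp]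
  gcongr
  · exact add_nonneg mgf_nonneg mgf_nonneg
  · linarith [Real.exp_le_exp.2 hθ2]

end BoundedIntegrand

section DominatedIntegrand

variable (S : GammaProcess P) {k M : ℝ → ℝ}
  (hk : ∀ t, AEMeasurable k (volume.restrict (Ioc 0 t)))
  (hkM : ∀ t, ∀ᵐ x ∂volume.restrict (Ioc 0 t), k x ∈ Icc 0 (M t))
  (hlim : Tendsto (cumul k) atTop atTop) (hM : Tendsto (fun t => M t / cumul k t) atTop (𝓝 0))
include hk hkM hlim hM

theorem tendsto_eLpNorm_ratio_sub_one {p : ℝ≥0} (hp : p ≠ 0) :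
    Tendsto (fun t => eLpNorm (fun ω => S.ratio k t ω - 1) p P) atTop (𝓝 0) := by
  have hbound : Tendsto (fun t => ENNReal.ofReal
      (2 * p * √(M t / cumul k t) * (2 * Real.exp (1 / 2)) ^ (p : ℝ)⁻¹)) atTop (𝓝 0) := by
    simpa using ENNReal.tendsto_ofReal ((hM.sqrt.const_mul (2 * (p : ℝ))).mul_const
      ((2 * Real.exp (1 / 2)) ^ (p : ℝ)⁻¹))
  refine tendsto_of_tendsto_of_tendsto_of_le_of_le' tendsto_const_nhds hbound
    (Eventually.of_forall fun _ => zero_le) ?_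
  filter_upwards [eventually_gt_atTop 0, hlim.eventually_gt_atTop 0,
    hM.eventually_le_const one_pos] with t ht hpos hle
  refine S.eLpNorm_ratio_sub_one_le ht (hk t) (hkM t) hpos hp ((div_le_one hpos).1 hle)

theorem orderlyDivergent_of_dominated [IsProbabilityMeasure P] (p : ℝ≥0) :
    OrderlyDivergent S p k := by
  have hLp : ∀ {q : ℝ≥0}, q ≠ 0 →
      Tendsto (fun t => eLpNorm (fun ω => S.ratio k t ω - 1) q P) atTop (𝓝 0) :=
    S.tendsto_eLpNorm_ratio_sub_one hk hkM hlim hM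
  have hmeas : ∀ t, AEStronglyMeasurable (S.ratio k t) P := fun t =>
    (S.aemeasurable_ratio (hk t)).aestronglyMeasurable
  refine ⟨fun t => Integrable.of_mem_Icc 0 (M t) (hk t) (hkM t), hlim, ?_⟩
  change ConvergesInLp P p (S.ratio k) 1
  rcases eq_or_ne p 0 with rfl | hp
  · refine ⟨Eventually.of_forall fun t => memLp_zero_iff_aestronglyMeasurable.2 (hmeas t), ?_⟩
    rw [if_pos rfl]
    exact tendstoInMeasure_of_tendsto_eLpNorm one_ne_zero hmeas aestronglyMeasurable_const
      (hLp one_ne_zero)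
  · refine ⟨?_, by rw [if_neg hp]; exact hLp hp⟩
    filter_upwards [(hLp hp).eventually_lt_const ENNReal.zero_lt_top] with t ht
    have hsub : MemLp (fun ω => S.ratio k t ω - 1) p P :=
      ⟨(hmeas t).sub aestronglyMeasurable_const, ht⟩
    simpa [Pi.add_def] using hsub.add (memLp_const (1 : ℝ))

end DominatedIntegrand

end GammaProcess

section LogGap

/-- The gap in the inequality `log (1 + y) ≤ y`; integrating it measures how far the Laplace
transform of a normalised Gamma integral is from that of its mean. -/
noncomputable def logGap (y : ℝ) : ℝ := y - Real.log (1 + y)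

theorem logGap_zero : logGap 0 = 0 := by simp [logGap]

theorem logGap_le_sq {y : ℝ} (hy : 0 ≤ y) : logGap y ≤ y ^ 2 := by
  have hlog := Real.one_sub_inv_le_log_of_pos (show 0 < 1 + y by linarith)
  have hinv : (1 + y)⁻¹ ≤ 1 - y + y ^ 2 := by
    rw [inv_le_iff_one_le_mul₀ (by linarith)]
    nlinarith [pow_nonneg hy 3]
  rw [logGap]
  linarith

theorem strictMonoOn_logGap : StrictMonoOn logGap (Ici 0) := by
  intro a (ha : 0 ≤ a) b (hb : 0 ≤ b) hab
  have ha' : 0 < 1 + a := by linarith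
  have hlog : Real.log (1 + b) - Real.log (1 + a) < (1 + b) / (1 + a) - 1 := by
    rw [← Real.log_div (by linarith) ha'.ne']
    exact Real.log_lt_sub_one_of_pos (by positivity) ((one_lt_div ha').2 (by linarith)).ne'
  have hdiv : (1 + b) / (1 + a) - 1 ≤ b - a := by
    rw [div_sub_one ha'.ne', div_le_iff₀ ha']
    nlinarith
  simp only [logGap]
  linarith

theorem logGap_nonneg {y : ℝ} (hy : 0 ≤ y) : 0 ≤ logGap y :=
  logGap_zero.ge.trans (strictMonoOn_logGap.monotoneOn self_mem_Ici hy hy)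

theorem convexOn_logGap : ConvexOn ℝ (Ici 0) logGap := by
  have hlog := (strictConcaveOn_log_Ioi.concaveOn.translate_right 1).subset
    (fun y (hy : 0 ≤ y) => show 0 < 1 + y by linarith) (convex_Ici 0)
  exact (convexOn_id (convex_Ici 0)).sub hlog

theorem continuousOn_logGap : ContinuousOn logGap (Ici 0) :=
  continuousOn_id.sub (ContinuousOn.log (by fun_prop) fun y (hy : 0 ≤ y) => by positivity)

theorem measurable_logGap : Measurable logGap := by
  unfold logGap
  fun_prop

theorem tendsto_zero_of_tendsto_logGap {ι : Type*} {l : Filter ι} {w : ι → ℝ}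
    (hw : ∀ᶠ i in l, 0 ≤ w i) (hlim : Tendsto (fun i => logGap (w i)) l (𝓝 0)) :
    Tendsto w l (𝓝 0) := by
  refine tendsto_order.2 ⟨fun y hy => hw.mono fun i hi => hy.trans_le hi, fun δ hδ => ?_⟩
  have hgap : 0 < logGap δ :=
    logGap_zero.symm.trans_lt (strictMonoOn_logGap self_mem_Ici hδ.le hδ)
  filter_upwards [hw, hlim.eventually_lt_const hgap] with i hi hlt
  exact (strictMonoOn_logGap.lt_iff_lt hi hδ.le).1 hlt

end LogGap

section LaplaceDeficit

variable {k : ℝ → ℝ} {T M : ℝ}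

/-- The quantity `log E[exp (-R_T(k))] + 1`, with the expectation written out by the Laplace
functional of the Gamma process, so that no process is needed to state it. -/
noncomputable def laplaceDeficit (k : ℝ → ℝ) (T : ℝ) : ℝ :=
  ∫ x in Ioc 0 T, logGap (k x / cumul k T)

theorem integrable_logGap_div {α : Type*} [MeasurableSpace α] {μ : Measure α} [IsFiniteMeasure μ]
    {h : α → ℝ} {c B : ℝ} (hc : 0 ≤ c) (hh : AEMeasurable h μ) (hB : ∀ᵐ x ∂μ, h x ∈ Icc 0 B) :
    Integrable (fun x => logGap (h x / c)) μ := by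
  refine Integrable.of_mem_Icc 0 (logGap (B / c))
    (measurable_logGap.comp_aemeasurable (hh.div_const c)) ?_
  filter_upwards [hB] with x ⟨h0, hx⟩
  have hnonneg : 0 ≤ h x / c := div_nonneg h0 hc
  have hle : h x / c ≤ B / c := div_le_div_of_nonneg_right hx hc
  exact ⟨logGap_nonneg hnonneg,
    strictMonoOn_logGap.monotoneOn hnonneg (hnonneg.trans hle) hle⟩

variable (hT : 0 ≤ T) (hk : AEMeasurable k (volume.restrict (Ioc 0 T)))
  (hkM : ∀ᵐ x ∂volume.restrict (Ioc 0 T), k x ∈ Icc 0 M) (hpos : 0 < cumul k T)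

include hkM hpos in
theorem laplaceDeficit_nonneg : 0 ≤ laplaceDeficit k T := by
  refine integral_nonneg_of_ae ?_
  filter_upwards [hkM] with x hx using logGap_nonneg (div_nonneg hx.1 hpos.le)

include hk hkM hpos in
theorem logGap_setIntegral_div_le {a : ℝ} (ha : 0 ≤ a) (haT : T = a + 1) :
    logGap ((∫ x in Ioc a T, k x) / cumul k T) ≤ laplaceDeficit k T := by
  have hsub : Ioc a T ⊆ Ioc 0 T := Ioc_subset_Ioc_left ha
  have hle : volume.restrict (Ioc a T) ≤ volume.restrict (Ioc 0 T) :=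
    Measure.restrict_mono hsub le_rfl
  have hprob : IsProbabilityMeasure (volume.restrict (Ioc a T)) := ⟨by simp [haT]⟩
  have hgap := integrable_logGap_div hpos.le hk hkM
  have hint : Integrable (fun x => k x / cumul k T) (volume.restrict (Ioc 0 T)) :=
    (Integrable.of_mem_Icc 0 M hk hkM).div_const _
  have hmem : ∀ᵐ x ∂volume.restrict (Ioc 0 T), k x / cumul k T ∈ Ici 0 := by
    filter_upwards [hkM] with x hx using div_nonneg hx.1 hpos.le
  calc logGap ((∫ x in Ioc a T, k x) / cumul k T)
      = logGap (∫ x in Ioc a T, k x / cumul k T) := by rw [integral_div]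
    _ ≤ ∫ x in Ioc a T, logGap (k x / cumul k T) :=
        convexOn_logGap.map_integral_le continuousOn_logGap isClosed_Ici
          (ae_mono hle hmem) (hint.mono_measure hle) (hgap.mono_measure hle)
    _ ≤ laplaceDeficit k T := by
        refine setIntegral_mono_set hgap ?_ (ae_of_all _ hsub)
        filter_upwards [hmem] with x hx using logGap_nonneg hx

include hT hk hkM hpos

theorem laplaceDeficit_le_vChar : laplaceDeficit k T ≤ vChar k T := by
  have hsqint : Integrable (fun x => k x ^ 2 / cumul k T ^ 2) (volume.restrict (Ioc 0 T)) := by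
    refine (Integrable.of_mem_Icc 0 (M ^ 2) (hk.pow_const 2) ?_).div_const _
    filter_upwards [hkM] with x hx using ⟨sq_nonneg _, pow_le_pow_left₀ hx.1 hx.2 2⟩
  calc laplaceDeficit k T ≤ ∫ x in Ioc 0 T, k x ^ 2 / cumul k T ^ 2 := by
        refine integral_mono_ae (integrable_logGap_div hpos.le hk hkM) hsqint ?_
        filter_upwards [hkM] with x hx
        simpa only [div_pow] using logGap_le_sq (div_nonneg hx.1 hpos.le)
    _ = vChar k T := by rw [integral_div, vChar, ← cumul_eq_setIntegral _ hT]

theorem GammaProcess.mgf_ratio_neg_one {Ω : Type*} [MeasurableSpace Ω] {P : Measure Ω}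
    (S : GammaProcess P) : mgf (S.ratio k T) P (-1) = Real.exp (laplaceDeficit k T - 1) := by
  have hT' : 0 < T := hT.lt_of_ne fun h0 => by simp [cumul, ← h0] at hpos
  have hint : Integrable (fun x => k x / cumul k T) (volume.restrict (Ioc 0 T)) :=
    (Integrable.of_mem_Icc 0 M hk hkM).div_const _
  have hmean : ∫ x in Ioc 0 T, k x / cumul k T = 1 := by
    rw [integral_div, ← cumul_eq_setIntegral k hT, div_self hpos.ne']
  have hmem : ∀ᵐ x ∂volume.restrict (Ioc 0 T),
      -1 / cumul k T * k x ∈ Icc (-(M / cumul k T)) 0 := by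
    filter_upwards [hkM] with x hx
    rw [neg_div, neg_mul, one_div_mul_eq_div]
    exact ⟨neg_le_neg (div_le_div_of_nonneg_right hx.2 hpos.le),
      neg_nonpos.2 (div_nonneg hx.1 hpos.le)⟩
  have hlog : ∀ x, -Real.log (1 - -1 / cumul k T * k x) =
      logGap (k x / cumul k T) - k x / cumul k T := fun x => by
    rw [logGap, neg_div, neg_mul, one_div_mul_eq_div]
    ring_nf
  rw [S.mgf_ratio hT' one_pos hk hmem, integral_congr_ae (ae_of_all _ hlog),
    integral_sub (integrable_logGap_div hpos.le hk hkM) hint, hmean, laplaceDeficit]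

end LaplaceDeficit

theorem tendsto_mgf_of_tendstoInMeasure_of_nonneg {Ω ι : Type*} [MeasurableSpace Ω]
    {μ : Measure Ω} [IsProbabilityMeasure μ] {l : Filter ι} [l.IsCountablyGenerated]
    {X : ι → Ω → ℝ} {c θ : ℝ} (hX : ∀ i, AEMeasurable (X i) μ)
    (hnonneg : ∀ᶠ i in l, ∀ᵐ ω ∂μ, 0 ≤ X i ω)
    (hc : 0 ≤ c) (hθ : θ ≤ 0) (hlim : TendstoInMeasure μ X l fun _ => c) :
    Tendsto (fun i => mgf (X i) μ θ) l (𝓝 (Real.exp (θ * c))) := by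
  -- Truncating at `0` makes `x ↦ exp (θ x)` a bounded test function.
  let φ : BoundedContinuousFunction ℝ ℝ := .ofNormedAddCommGroup
    (fun x => Real.exp (θ * max x 0)) (by fun_prop) 1 fun x => by
      rw [Real.norm_of_nonneg (Real.exp_pos _).le, Real.exp_le_one_iff]
      exact mul_nonpos_of_nonpos_of_nonneg hθ (le_max_right _ _)
  have hdist := ProbabilityMeasure.tendsto_iff_forall_integral_tendsto.1
    (hlim.tendstoInDistribution_of_aemeasurable hX aemeasurable_const).tendsto φ
  have hlimit : ∫ x, φ x ∂μ.map (fun _ => c) = Real.exp (θ * c) := by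
    rw [integral_map aemeasurable_const φ.continuous.aestronglyMeasurable]
    simp [φ, hc]
  rw [ProbabilityMeasure.coe_mk, hlimit] at hdist
  refine hdist.congr' ?_
  filter_upwards [hnonneg] with i hi
  rw [ProbabilityMeasure.coe_mk, integral_map (hX i) φ.continuous.aestronglyMeasurable, mgf]
  refine integral_congr_ae ?_
  filter_upwards [hi] with ω hω
  simp [φ, hω]

section Monotone

variable {f : ℝ → ℝ}

theorem aemeasurable_restrict_Ioc_of_monotoneOn (hmono : MonotoneOn f (Ici 0)) (t : ℝ) :
    AEMeasurable f (volume.restrict (Ioc 0 t)) :=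
  aemeasurable_restrict_of_monotoneOn measurableSet_Ioc (hmono.mono fun _ hx => hx.1.le)

theorem intervalIntegrable_of_monotoneOn_Ici (hmono : MonotoneOn f (Ici 0)) {a b : ℝ} (ha : 0 ≤ a)
    (hb : 0 ≤ b) : IntervalIntegrable f volume a b :=
  (hmono.mono fun _ hx => (le_inf ha hb).trans hx.1).intervalIntegrable

variable (hf : ∀ x, 0 ≤ x → 0 ≤ f x) (hmono : MonotoneOn f (Ici 0))
include hf hmono

theorem ae_mem_Icc_of_monotoneOn (t : ℝ) :
    ∀ᵐ x ∂volume.restrict (Ioc 0 t), f x ∈ Icc 0 (f t) := by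
  filter_upwards [ae_restrict_mem measurableSet_Ioc] with x hx
  exact ⟨hf x hx.1.le, hmono hx.1.le (hx.1.le.trans hx.2) hx.2⟩

theorem memLp_restrict_Ioc_of_monotoneOn (p : ℝ≥0∞) (t : ℝ) :
    MemLp f p (volume.restrict (Ioc 0 t)) :=
  memLp_of_bounded (ae_mem_Icc_of_monotoneOn hf hmono t)
    (aemeasurable_restrict_Ioc_of_monotoneOn hmono t).aestronglyMeasurable p

theorem bChar_le_div_one_sub {t w : ℝ} (ht : 0 ≤ t) (hpos : 0 < cumul f t)
    (hw : w = (∫ x in Ioc t (t + 1), f x) / cumul f (t + 1)) : bChar f t ≤ w / (1 - w) := by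
  have ht1 : 0 ≤ t + 1 := by linarith
  set x := ∫ x in Ioc t (t + 1), f x
  have hsplit : cumul f t + x = cumul f (t + 1) := by
    rw [cumul, cumul, ← intervalIntegral.integral_add_adjacent_intervals
      (intervalIntegrable_of_monotoneOn_Ici hmono le_rfl ht)
      (intervalIntegrable_of_monotoneOn_Ici hmono ht ht1),
      intervalIntegral.integral_of_le (le_add_of_nonneg_right zero_le_one)]
  have hfx : f t ≤ x := by
    have := setIntegral_mono_on (μ := volume) (s := Ioc t (t + 1)) (f := fun _ => f t) (g := f)
      (by simp) (intervalIntegrable_of_monotoneOn_Ici hmono ht ht1).1 measurableSet_Ioc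
      fun y hy => hmono ht (ht.trans hy.1.le) hy.1.le
    simpa using this
  have hx : 0 ≤ x := (hf t ht).trans hfx
  have hquot : w / (1 - w) = x / cumul f t := by
    have hsum : cumul f t + x ≠ 0 := by positivity
    rw [hw, ← hsplit, one_sub_div hsum, add_sub_cancel_right, div_div_div_cancel_right₀ hsum]
  rw [hquot, bChar]
  gcongr

theorem tendsto_bChar_of_tendsto_laplaceDeficit (hlim : Tendsto (cumul f) atTop atTop)
    (hdef : Tendsto (laplaceDeficit f) atTop (𝓝 0)) : Tendsto (bChar f) atTop (𝓝 0) := by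
  let w : ℝ → ℝ := fun t => (∫ x in Ioc t (t + 1), f x) / cumul f (t + 1)
  have hshift : Tendsto (fun t : ℝ => t + 1) atTop atTop :=
    tendsto_atTop_add_const_right _ _ tendsto_id
  have hw0 : ∀ᶠ t in atTop, 0 ≤ w t := by
    filter_upwards [eventually_ge_atTop 0, (hlim.comp hshift).eventually_gt_atTop 0]
      with t ht hpos
    exact div_nonneg (setIntegral_nonneg measurableSet_Ioc fun x hx => hf x (ht.trans hx.1.le))
      hpos.le
  have hgap : Tendsto (fun t => logGap (w t)) atTop (𝓝 0) := by
    refine squeeze_zero' (hw0.mono fun t => logGap_nonneg) ?_ (hdef.comp hshift)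
    filter_upwards [eventually_ge_atTop 0, (hlim.comp hshift).eventually_gt_atTop 0]
      with t ht hpos
    exact logGap_setIntegral_div_le (aemeasurable_restrict_Ioc_of_monotoneOn hmono _)
      (ae_mem_Icc_of_monotoneOn hf hmono _) hpos ht rfl
  have hw : Tendsto w atTop (𝓝 0) := tendsto_zero_of_tendsto_logGap hw0 hgap
  have hbound : Tendsto (fun t => w t / (1 - w t)) atTop (𝓝 0) := by
    simpa [Pi.div_def] using hw.div (hw.const_sub 1) (by norm_num)
  refine squeeze_zero' ?_ ?_ hbound <;>
    filter_upwards [eventually_ge_atTop 0, hlim.eventually_gt_atTop 0] with t ht hpos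
  · exact div_nonneg (hf t ht) hpos.le
  · exact bChar_le_div_one_sub hf hmono ht hpos rfl

theorem tendsto_laplaceDeficit_of_inClassV (hV : InClassV f) :
    Tendsto (laplaceDeficit f) atTop (𝓝 0) := by
  refine squeeze_zero' ?_ ?_ hV.2.2 <;>
    filter_upwards [eventually_ge_atTop 0, hV.2.1.eventually_gt_atTop 0] with t ht hpos
  · exact laplaceDeficit_nonneg (ae_mem_Icc_of_monotoneOn hf hmono t) hpos
  · exact laplaceDeficit_le_vChar ht (aemeasurable_restrict_Ioc_of_monotoneOn hmono t)
      (ae_mem_Icc_of_monotoneOn hf hmono t) hpos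

theorem tendsto_laplaceDeficit_of_inClassOD (hOD : InClassOD.{u} f) :
    Tendsto (laplaceDeficit f) atTop (𝓝 0) := by
  obtain ⟨Ω, _, P, _, S, -, hlim, -, hprob⟩ := hOD
  rw [if_pos rfl] at hprob
  change TendstoInMeasure P (S.ratio f) atTop _ at hprob
  have hmeas := aemeasurable_restrict_Ioc_of_monotoneOn hmono
  have hmem := ae_mem_Icc_of_monotoneOn hf hmono
  have hratio : ∀ᶠ t in atTop, ∀ᵐ ω ∂P, 0 ≤ S.ratio f t ω := by
    filter_upwards [hlim.eventually_ge_atTop 0] with t ht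
    refine ae_of_all _ fun ω => div_nonneg ?_ ht
    exact setIntegral_nonneg measurableSet_Ioc fun x hx => hf x hx.1.le
  have hmgf : Tendsto (fun t => mgf (S.ratio f t) P (-1)) atTop (𝓝 (Real.exp (-1 * 1))) :=
    tendsto_mgf_of_tendstoInMeasure_of_nonneg (fun t => S.aemeasurable_ratio (hmeas t)) hratio
      zero_le_one (by norm_num) hprob
  have hlog := (hmgf.log (Real.exp_pos _).ne').add_const 1
  rw [Real.log_exp, mul_one, neg_add_cancel] at hlog
  refine hlog.congr' ?_
  filter_upwards [eventually_ge_atTop 0, hlim.eventually_gt_atTop 0] with t ht hpos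
  rw [S.mgf_ratio_neg_one ht (hmeas t) (hmem t) hpos, Real.log_exp, sub_add_cancel]

theorem inClassB_of_monotoneOn (h : InClassOD.{u} f ∨ InClassV f ∨ InClassB f) : InClassB f := by
  have hint : ∀ t, IntegrableOn f (Ioc 0 t) := fun t =>
    memLp_one_iff_integrable.1 (memLp_restrict_Ioc_of_monotoneOn hf hmono 1 t)
  rcases h with hOD | hV | hB
  · have hlim : Tendsto (cumul f) atTop atTop := by
      obtain ⟨_, _, _, _, _, -, hlim, -⟩ := hOD
      exact hlim
    exact ⟨hint, hlim, tendsto_bChar_of_tendsto_laplaceDeficit hf hmono hlim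
      (tendsto_laplaceDeficit_of_inClassOD hf hmono hOD)⟩
  · exact ⟨hint, hV.2.1, tendsto_bChar_of_tendsto_laplaceDeficit hf hmono hV.2.1
      (tendsto_laplaceDeficit_of_inClassV hf hmono hV)⟩
  · exact hB

end Monotone

section PeriodicFactor

variable {f g : ℝ → ℝ} {T : ℝ}

theorem ae_eq_zero_of_periodic (hT : 0 < T) (hper : Function.Periodic g T)
    (hzero : g =ᵐ[volume.restrict (Ioc 0 T)] 0) : g =ᵐ[volume] 0 := by
  have hdom := isAddFundamentalDomain_Ioc hT 0
  rw [zero_add] at hdom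
  refine hdom.measure_zero_of_invariant _ (fun z => ?_) ?_
  · ext x
    rw [mem_vadd_set_iff_neg_vadd_mem]
    obtain ⟨n, hn⟩ := (-z).2
    have hshift : g (-z +ᵥ x) = g x := by
      rw [AddSubgroup.vadd_def, ← hn, vadd_eq_add, add_comm]
      exact hper.zsmul n x
    simp [hshift]
  · rwa [← Measure.restrict_apply' measurableSet_Ioc]

theorem intervalIntegrable_mul_of_monotoneOn_Ici (hmono : MonotoneOn f (Ici 0)) {a b : ℝ}
    (ha : 0 ≤ a) (hab : a ≤ b) (hg : IntervalIntegrable g volume a b) :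
    IntervalIntegrable (fun x => f x * g x) volume a b := by
  rw [intervalIntegrable_iff_integrableOn_Ioc_of_le hab] at hg ⊢
  refine hg.bdd_mul (c := max |f a| |f b|) ?_ ?_
  · exact (intervalIntegrable_of_monotoneOn_Ici hmono ha (ha.trans hab)).1.aestronglyMeasurable
  · filter_upwards [ae_restrict_mem measurableSet_Ioc] with x hx
    have hx0 : 0 ≤ x := ha.trans hx.1.le
    exact abs_le_max_abs_abs (hmono ha hx0 hx.1.le) (hmono hx0 (hx0.trans hx.2) hx.2)

theorem integral_le_sub_mul_of_monotoneOn_Ici (hmono : MonotoneOn f (Ici 0)) {a b : ℝ}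
    (ha : 0 ≤ a) (hab : a ≤ b) : ∫ x in a..b, f x ≤ (b - a) * f b := by
  have hle := intervalIntegral.integral_mono_on (g := fun _ => f b) hab
    (intervalIntegrable_of_monotoneOn_Ici hmono ha (ha.trans hab)) (by simp)
    fun x hx => hmono (ha.trans hx.1) (ha.trans hab) hx.2
  simpa using hle

variable (hf : ∀ x, 0 ≤ x → 0 ≤ f x) (hmono : MonotoneOn f (Ici 0)) (hT : 0 < T)
  (hper : Function.Periodic g T) (hg0 : ∀ x, 0 ≤ g x)
  (hg : ∀ a b, IntervalIntegrable g volume a b)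

include hmono hT hper hg0 hg in
theorem mul_integral_period_le_integral_mul {t : ℝ} (ht : 0 ≤ t) :
    f t * ∫ x in (0 : ℝ)..T, g x ≤ ∫ x in t..t + T, f x * g x := by
  have hper' := hper.intervalIntegral_add_eq 0 t
  rw [zero_add] at hper'
  rw [hper', ← intervalIntegral.integral_const_mul]
  exact intervalIntegral.integral_mono_on (by linarith) ((hg t (t + T)).const_mul _)
    (intervalIntegrable_mul_of_monotoneOn_Ici hmono ht (by linarith) (hg _ _))
    fun x hx => mul_le_mul_of_nonneg_right (hmono ht (ht.trans hx.1) hx.1) (hg0 x)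

include hf hmono hT hper hg0 hg

theorem periodAverage_mul_integral_le_integral_mul {s t : ℝ} (hs : 0 ≤ s) (hst : s ≤ t)
    (htT : t - s ≤ T) :
    (∫ x in (0 : ℝ)..T, g x) / T * ∫ x in s..t, f x ≤ ∫ x in t..t + T, f x * g x := by
  have ht : 0 ≤ t := hs.trans hst
  have hg_int : 0 ≤ ∫ x in (0 : ℝ)..T, g x :=
    intervalIntegral.integral_nonneg hT.le fun x _ => hg0 x
  have hft := hf t ht
  calc (∫ x in (0 : ℝ)..T, g x) / T * ∫ x in s..t, f x
      ≤ (∫ x in (0 : ℝ)..T, g x) / T * ((t - s) * f t) := by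
        gcongr
        exact integral_le_sub_mul_of_monotoneOn_Ici hmono hs hst
    _ ≤ (∫ x in (0 : ℝ)..T, g x) / T * (T * f t) := by gcongr
    _ = f t * ∫ x in (0 : ℝ)..T, g x := by field_simp
    _ ≤ ∫ x in t..t + T, f x * g x :=
        mul_integral_period_le_integral_mul hmono hT hper hg0 hg ht

theorem periodAverage_mul_cumul_le_cumul_mul {t : ℝ} (ht : 0 ≤ t) :
    (∫ x in (0 : ℝ)..T, g x) / T * cumul f t ≤ cumul (fun x => f x * g x) (t + T) := by
  set m := (∫ x in (0 : ℝ)..T, g x) / T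
  have hnonneg : ∀ {s}, 0 ≤ s → 0 ≤ cumul (fun x => f x * g x) s := fun hs =>
    intervalIntegral.integral_nonneg hs fun x hx => mul_nonneg (hf x hx.1) (hg0 x)
  have hfg : ∀ {a b}, 0 ≤ a → a ≤ b → IntervalIntegrable (fun x => f x * g x) volume a b :=
    fun ha hab => intervalIntegrable_mul_of_monotoneOn_Ici hmono ha hab (hg _ _)
  obtain ⟨n, hn⟩ : ∃ n : ℕ, t ≤ n * T := by
    obtain ⟨n, hn⟩ := exists_nat_ge (t / T)
    exact ⟨n, (div_le_iff₀ hT).1 hn⟩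
  induction n generalizing t with
  | zero =>
    obtain rfl : t = 0 := le_antisymm (by simpa using hn) ht
    simpa [cumul] using hnonneg (s := 0 + T) (by linarith)
  | succ n ih =>
    -- The `f`-mass of each period is compared with the `f g`-mass of the next one.
    let s := max (t - T) 0
    have hs : 0 ≤ s := le_max_right _ _
    have hst : s ≤ t := max_le (by linarith) ht
    have hpast : m * cumul f s ≤ cumul (fun x => f x * g x) t := by
      rcases le_total (t - T) 0 with htT | htT
      · simpa [s, htT, cumul] using hnonneg ht
      · have hprev := ih htT (by push_cast at hn; linarith)
        rwa [sub_add_cancel, ← max_eq_left htT] at hprev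
    have hlast : m * ∫ x in s..t, f x ≤ ∫ x in t..t + T, f x * g x :=
      periodAverage_mul_integral_le_integral_mul hf hmono hT hper hg0 hg hs hst
        (by linarith [le_max_left (t - T) 0])
    calc m * cumul f t = m * cumul f s + m * ∫ x in s..t, f x := by
          rw [← mul_add, cumul, cumul, intervalIntegral.integral_add_adjacent_intervals
            (intervalIntegrable_of_monotoneOn_Ici hmono le_rfl hs)
            (intervalIntegrable_of_monotoneOn_Ici hmono hs ht)]
      _ ≤ cumul (fun x => f x * g x) t + ∫ x in t..t + T, f x * g x := add_le_add hpast hlast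
      _ = cumul (fun x => f x * g x) (t + T) :=
          intervalIntegral.integral_add_adjacent_intervals (hfg le_rfl ht) (hfg ht (by linarith))

theorem periodAverage_mul_cumul_sub_le_cumul_mul {t : ℝ} (hTt : T ≤ t) :
    (∫ x in (0 : ℝ)..T, g x) / T * (cumul f t - T * f t) ≤ cumul (fun x => f x * g x) t := by
  have hprev : 0 ≤ t - T := sub_nonneg.2 hTt
  have hlast := integral_le_sub_mul_of_monotoneOn_Ici hmono hprev (sub_le_self t hT.le)
  have hsplit : cumul f (t - T) + ∫ x in t - T..t, f x = cumul f t :=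
    intervalIntegral.integral_add_adjacent_intervals
      (intervalIntegrable_of_monotoneOn_Ici hmono le_rfl hprev)
      (intervalIntegrable_of_monotoneOn_Ici hmono hprev (hT.le.trans hTt))
  calc (∫ x in (0 : ℝ)..T, g x) / T * (cumul f t - T * f t)
      ≤ (∫ x in (0 : ℝ)..T, g x) / T * cumul f (t - T) := by
        gcongr
        · exact div_nonneg (intervalIntegral.integral_nonneg hT.le fun x _ => hg0 x) hT.le
        · linarith
    _ ≤ cumul (fun x => f x * g x) (t - T + T) :=
        periodAverage_mul_cumul_le_cumul_mul hf hmono hT hper hg0 hg hprev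
    _ = cumul (fun x => f x * g x) t := by rw [sub_add_cancel]

theorem eventually_mul_cumul_le_cumul_mul (hB : InClassB f) :
    ∀ᶠ t in atTop,
      (∫ x in (0 : ℝ)..T, g x) / T / 2 * cumul f t ≤ cumul (fun x => f x * g x) t := by
  filter_upwards [eventually_ge_atTop T, hB.2.1.eventually_gt_atTop 0,
    hB.2.2.eventually_le_const (show 0 < 1 / (2 * T) by positivity)] with t hTt hpos hbt
  have hsmall : f t * (2 * T) ≤ 1 * cumul f t := (div_le_div_iff₀ hpos (by positivity)).1 hbt
  refine le_trans ?_ (periodAverage_mul_cumul_sub_le_cumul_mul hf hmono hT hper hg0 hg hTt)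
  rw [div_mul_eq_mul_div, mul_div_assoc]
  gcongr
  · exact div_nonneg (intervalIntegral.integral_nonneg hT.le fun x _ => hg0 x) hT.le
  · linarith

end PeriodicFactor

theorem vChar_le_of_mul_cumul_le {h k : ℝ → ℝ} {c t : ℝ} (hc : 0 < c) (ht : 0 ≤ t)
    (hk : IntegrableOn (fun x => k x ^ 2) (Ioc 0 t))
    (hhk : ∀ᵐ x ∂volume.restrict (Ioc 0 t), h x ^ 2 ≤ k x ^ 2) (hpos : 0 < cumul k t)
    (hle : c * cumul k t ≤ cumul h t) : vChar h t ≤ 1 / c ^ 2 * vChar k t := by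
  have hsq : cumul (fun x => h x ^ 2) t ≤ cumul (fun x => k x ^ 2) t := by
    rw [cumul_eq_setIntegral _ ht, cumul_eq_setIntegral _ ht]
    exact integral_mono_of_nonneg (ae_of_all _ fun x => sq_nonneg _) hk hhk
  have hsq0 : 0 ≤ cumul (fun x => k x ^ 2) t :=
    intervalIntegral.integral_nonneg ht fun x _ => sq_nonneg _
  calc vChar h t ≤ cumul (fun x => k x ^ 2) t / (c * cumul k t) ^ 2 := by
        unfold vChar
        gcongr
    _ = 1 / c ^ 2 * vChar k t := by
        rw [vChar]
        field_simp

namespace IsRegularPeriodicFactor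

variable {f g : ℝ → ℝ} (hg : IsRegularPeriodicFactor g)
include hg

theorem ae_le_one : ∀ᵐ x, g x ≤ 1 := by
  -- The real-valued `essSup` of an unbounded function is `0`.
  have hbdd : IsBoundedUnder (· ≤ ·) (ae volume) g := by
    by_contra hunbdd
    exact zero_ne_one ((Real.limsup_of_not_isBoundedUnder hunbdd).symm.trans hg.essSup_eq_one)
  simpa only [hg.essSup_eq_one] using ae_le_essSup hbdd

theorem intervalIntegrable (a b : ℝ) : IntervalIntegrable g volume a b := by
  refine (intervalIntegrable_const (c := (1 : ℝ))).mono_fun' hg.measurable.aestronglyMeasurable ?_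
  filter_upwards [ae_restrict_of_ae hg.ae_le_one] with x hx
  rwa [Real.norm_of_nonneg (hg.nonneg x)]

theorem integral_period_pos {T : ℝ} (hT : 0 < T) (hper : Function.Periodic g T) :
    0 < ∫ x in (0 : ℝ)..T, g x := by
  refine (intervalIntegral.integral_nonneg hT.le fun x _ => hg.nonneg x).lt_of_ne fun hzero => ?_
  rw [intervalIntegral.integral_of_le hT.le, eq_comm,
    integral_eq_zero_iff_of_nonneg hg.nonneg (hg.intervalIntegrable 0 T).1] at hzero
  have hess := essSup_congr_ae (ae_eq_zero_of_periodic hT hper hzero)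
  rw [hg.essSup_eq_one, Pi.zero_def, essSup_const'] at hess
  exact one_ne_zero hess

theorem exists_pos_eventually_mul_cumul_le : ∃ c : ℝ, 0 < c ∧ ∀ f : ℝ → ℝ,
    (∀ x, 0 ≤ x → 0 ≤ f x) → MonotoneOn f (Ici 0) → InClassB f →
      ∀ᶠ t in atTop, c * cumul f t ≤ cumul (fun x => f x * g x) t := by
  obtain ⟨T, hT, hper⟩ := hg.periodic
  have hpos := hg.integral_period_pos hT hper
  exact ⟨(∫ x in (0 : ℝ)..T, g x) / T / 2, by positivity, fun f hf hmono hB =>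
    eventually_mul_cumul_le_cumul_mul hf hmono hT hper hg.nonneg hg.intervalIntegrable hB⟩

theorem aemeasurable_mul (hmono : MonotoneOn f (Ici 0)) (t : ℝ) :
    AEMeasurable (fun x => f x * g x) (volume.restrict (Ioc 0 t)) :=
  (aemeasurable_restrict_Ioc_of_monotoneOn hmono t).mul hg.measurable.aemeasurable

theorem ae_mul_mem_Icc (hf : ∀ x, 0 ≤ x → 0 ≤ f x) (hmono : MonotoneOn f (Ici 0)) (t : ℝ) :
    ∀ᵐ x ∂volume.restrict (Ioc 0 t), f x * g x ∈ Icc 0 (f t) := by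
  filter_upwards [ae_mem_Icc_of_monotoneOn hf hmono t, ae_restrict_of_ae hg.ae_le_one]
    with x ⟨hx0, hxt⟩ hgx
  exact ⟨mul_nonneg hx0 (hg.nonneg x), (mul_le_of_le_one_right hx0 hgx).trans hxt⟩

theorem ae_mul_sq_le_sq (hf : ∀ x, 0 ≤ x → 0 ≤ f x) (t : ℝ) :
    ∀ᵐ x ∂volume.restrict (Ioc 0 t), (f x * g x) ^ 2 ≤ f x ^ 2 := by
  filter_upwards [ae_restrict_mem measurableSet_Ioc, ae_restrict_of_ae hg.ae_le_one] with x hx hgx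
  have hfx := hf x hx.1.le
  exact pow_le_pow_left₀ (mul_nonneg hfx (hg.nonneg x)) (mul_le_of_le_one_right hfx hgx) 2

end IsRegularPeriodicFactor

theorem tendsto_div_cumul_of_mul_cumul_le {f h : ℝ → ℝ} {c : ℝ} (hf : ∀ x, 0 ≤ x → 0 ≤ f x)
    (hB : InClassB f) (hc : 0 < c) (hle : ∀ᶠ t in atTop, c * cumul f t ≤ cumul h t) :
    Tendsto (fun t => f t / cumul h t) atTop (𝓝 0) := by
  have hbound : Tendsto (fun t => c⁻¹ * bChar f t) atTop (𝓝 0) := by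
    simpa using hB.2.2.const_mul c⁻¹
  refine squeeze_zero' ?_ ?_ hbound <;>
    filter_upwards [hle, eventually_ge_atTop 0, hB.2.1.eventually_gt_atTop 0] with t hle ht hpos
  · exact div_nonneg (hf t ht) ((mul_pos hc hpos).le.trans hle)
  · calc f t / cumul h t ≤ f t / (c * cumul f t) := by
          gcongr
          exact hf t ht
      _ = c⁻¹ * bChar f t := by rw [bChar, div_mul_eq_div_div_swap, div_eq_inv_mul]

theorem mainTheorem6 (g : ℝ → ℝ) (hg : IsRegularPeriodicFactor g) :
    ∃ C : ℝ, 0 < C ∧ ∀ f : ℝ → ℝ, (∀ x, 0 ≤ x → 0 ≤ f x) → MonotoneOn f (Set.Ici 0) →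
      (InClassOD.{u} f ∨ InClassV f ∨ InClassB f) →
        (∀ t, MemLp (fun x => f x * g x) 2 (volume.restrict (Set.Ioc 0 t))) ∧
        (∀ᶠ t in atTop, vChar (fun x => f x * g x) t ≤ C * vChar f t) ∧
        ∀ (Ω : Type v) [MeasurableSpace Ω] (P : Measure Ω) [IsProbabilityMeasure P]
          (S : GammaProcess P) (p : ℝ≥0), OrderlyDivergent S p (fun x => f x * g x) := by
  obtain ⟨c, hc, hcumul⟩ := hg.exists_pos_eventually_mul_cumul_le
  refine ⟨1 / c ^ 2, by positivity, fun f hf hmono hclass => ?_⟩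
  have hB : InClassB f := inClassB_of_monotoneOn hf hmono hclass
  have hle := hcumul f hf hmono hB
  have hmeas := hg.aemeasurable_mul hmono
  have hmem := hg.ae_mul_mem_Icc hf hmono
  refine ⟨fun t => memLp_of_bounded (hmem t) (hmeas t).aestronglyMeasurable 2, ?_,
    fun Ω _ P _ S p => S.orderlyDivergent_of_dominated hmeas hmem ?_ ?_ p⟩
  · filter_upwards [hle, eventually_ge_atTop 0, hB.2.1.eventually_gt_atTop 0] with t hle ht hpos
    exact vChar_le_of_mul_cumul_le hc ht
      (memLp_restrict_Ioc_of_monotoneOn hf hmono 2 t).integrable_sq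
      (hg.ae_mul_sq_le_sq hf t) hpos hle
  · exact tendsto_atTop_mono' atTop hle (hB.2.1.const_mul_atTop hc)
  · exact tendsto_div_cumul_of_mul_cumul_le hf hB hc hle
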